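/- A path is a finite walk on the square grid starting at $(0,0)$ with unit steps north ($N$) and east ($E$). Let $v$ be any path. **The poset $\mathrm{Tam}(v)$.** Its elements are the paths $u$ from $(0,0)$ to the end of $v$ that are weakly above $v$. For an integer point $p$ of such a $u$, let $\mathrm{horiz}_v(p)$ be the maximum number of east steps that can be added to the right of $p$ without crossing $v$. Suppose that $p$ is preceded by an east step $E$ and followed by a north step in $u$, let $p'$ be the first point of $u$ after $p$ with $\mathrm{horiz}_v(p')=\mathrm{horiz}_v(p)$, and let $D$ be the part of $u$ from $p$ to $p'$. If $u'$ is obtained from $u$ by exchanging $E$ and $D$ (so $u=P\,E\,D\,S$ and $u'=P\,D\,E\,S$), write $u<_v u'$. The order of $\mathrm{Tam}(v)$ is the reflexive transitive closure of $<_v$. **The poset $I(v)$.** A complete binary tree $\overline T$ is a binary tree all of whose vertices have $0$ (external vertices) or $2$ (internal vertices) children; deleting its external vertices gives a binary tree $T$. We only consider $\overline T$ with at least one internal vertex. Walk around $T$ starting at the root, left subtrees first, and write $a$, $\bar a$ for the first and the second passage along a left edge, and $b$, $\bar b$ for the first and the second passage along a right edge. Keeping only $\bar a$ (read as $N$) and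 $\bar b$ (read as $E$) gives the path $u(T)$; keeping only $\bar a$ (read as $N$) and $b$ (read as $E$) gives the path $v(T)$, the interior canopy of $\overline T$. A right rotation replaces, at an internal vertex, the subtree $((A,B),C)$ by $(A,(B,C))$, where $A,B,C$ are complete binary trees; it is valid if $B$ has more than one vertex. The Tamari order is the reflexive transitive closure of right rotation, and $I(v)$ is the set of complete binary trees with interior canopy $v$, with the restriction of the Tamari order. **Proposition.** For any path $v$, the map $\overline T\mapsto u(T)$ is an isomorphism of posets from $I(v)$ to $\mathrm{Tam}(v)$. Moreover: 1. For every $\overline T\in I(v)$ and every complete binary tree $\overline S$, $\overline S$ is obtained from $\overline T$ by a valid right rotation if and only if $\overline S\in I(v)$ and $u(T)<_v u(S)$. 2. For $u,u'\in\mathrm{Tam}(v)$, $u'$ covers $u$ in the poset $\mathrm{Tam}(v)$ if and only if $u<_v u'$. 3. For every $\overline T\in I(v)$, the sequence of right heights of the vertices of $T$ in post-order (the right height of a vertex is the number of right edges on the walk from the root to it) equals the sequence of values $\mathrm{horiz}_v(p)$ for the consecutive integer points $p$ of $u(T)$ from $(0,0)$ to the end. -/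

import Mathlib

/-! ### Paths on the square grid and the poset of paths weakly above `v` -/

/-- A unit step on the square grid: north or east. -/
inductive GridStep where
  | N : GridStep
  | E : GridStep
  deriving DecidableEq

/-- A path is a finite walk starting at `(0,0)` with north and east unit steps. -/
abbrev GridPath := List GridStep

namespace GridPath

open GridStep

/-- The point `(x, y)` where a path ends. -/
def endpoint (u : GridPath) : ℕ × ℕ := (u.count E, u.count N)

/-- The consecutive integer points on a path, from `(0,0)` to the end (a path with `m` steps
has `m + 1` of them). -/
def points (u : GridPath) : List (ℕ × ℕ) := u.inits.map endpoint

/-- The point `p` is weakly above `v`: at the height of `p`, some point of `v` is at `p` or to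
the right of `p`. -/
def PointAbove (v : GridPath) (p : ℕ × ℕ) : Prop :=
  ∃ q ∈ points v, q.2 = p.2 ∧ p.1 ≤ q.1

/-- The path `u` is weakly above the path `v`, and has the same end. -/
def IsAbove (v u : GridPath) : Prop :=
  endpoint u = endpoint v ∧ ∀ p ∈ points u, PointAbove v p

/-- The horizontal distance of `p`: the maximum number of east steps that can be added to the
right of `p` without crossing `v`. -/
noncomputable def horiz (v : GridPath) (p : ℕ × ℕ) : ℕ :=
  sSup {k : ℕ | ∀ j ≤ k, PointAbove v (p.1 + j, p.2)}

/-- The elementary relation `u <_v u'`. Here `u = P E D S`, the point `p` is the end of `P E`,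
the step of `u` after `p` is a north step, `D` is the part of `u` from `p` to the first later
point `p'` of `u` with the same horizontal distance as `p`, and `u' = P D E S`. -/
def TamStep (v u u' : GridPath) : Prop :=
  ∃ P D S : GridPath,
    u = P ++ [E] ++ D ++ S ∧
    u' = P ++ D ++ [E] ++ S ∧
    D.head? = some N ∧
    horiz v (endpoint (P ++ [E] ++ D)) = horiz v (endpoint (P ++ [E])) ∧
    ∀ D' : GridPath, D' <+: D → D' ≠ [] → D' ≠ D →
      horiz v (endpoint (P ++ [E] ++ D')) ≠ horiz v (endpoint (P ++ [E]))

/-- Auxiliary statistic for antisymmetry: the number of pairs formed by an east step and a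
later north step. -/
def inv : GridPath → ℕ
  | [] => 0
  | E :: l => l.count N + inv l
  | N :: l => inv l

theorem inv_append (l m : GridPath) : inv (l ++ m) = inv l + inv m + l.count E * m.count N := by
  induction l with
  | nil => simp [inv]
  | cons a l ih => cases a <;> simp [inv, ih] <;> ring

theorem TamStep.inv_lt {v u u' : GridPath} (h : TamStep v u u') : inv u' < inv u := by
  obtain ⟨P, D, S, rfl, rfl, hD, -, -⟩ := h
  have : 0 < D.count N := by
    cases D with
    | nil => simp at hD
    | cons a D => simp at hD; subst hD; simp
  simp only [inv_append, List.count_append]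
  simp [inv]
  nlinarith

end GridPath

/-- The set of paths underlying `Tam(v)`: the paths weakly above `v` that start at `(0,0)` and
finish at the end of `v`. -/
def Tam (v : GridPath) : Type := {u : GridPath // GridPath.IsAbove v u}

/-- The order of `Tam(v)` is the reflexive transitive closure of the elementary relation. -/
instance Tam.instPartialOrder (v : GridPath) : PartialOrder (Tam v) where
  le := Relation.ReflTransGen fun u u' => GridPath.TamStep v u.1 u'.1
  le_refl _ := Relation.ReflTransGen.refl
  le_trans _ _ _ := Relation.ReflTransGen.trans
  le_antisymm a b hab hba := by
    have key : ∀ x y : Tam v,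
        Relation.ReflTransGen (fun u u' : Tam v => GridPath.TamStep v u.1 u'.1) x y →
        GridPath.inv y.1 ≤ GridPath.inv x.1 := by
      intro x y h
      induction h with
      | refl => exact le_rfl
      | tail _ h ih => exact (h.inv_lt.le).trans ih
    rcases Relation.ReflTransGen.cases_head hab with h | ⟨c, hc, hcb⟩
    · exact h
    · exact absurd (hc.inv_lt.trans_le (key _ _ hba)) (not_lt.mpr (key _ _ hcb))

/-! ### Binary trees

A term of `BinaryTree Unit` is read in two ways. As a binary tree `T`, `nil` is the empty tree
and `node () L R` is the triple `(L, r, R)`. As a complete binary tree `T̄`, `nil` is an external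
vertex and each `node` is an internal vertex with its two children. Deleting the external
vertices of `T̄` gives `T`, so that both readings are of the same term. -/

namespace CanopyTree

open BinaryTree

/-- The letters `a`, `ā`, `b`, `b̄` of the word of a binary tree: first and second passage
along a left edge, first and second passage along a right edge. -/
inductive Letter where
  | a : Letter
  | aBar : Letter
  | b : Letter
  | bBar : Letter
  deriving DecidableEq

/-- The word `w(T)` read while walking around `T` from the root, left subtree first. -/
def word : BinaryTree Unit → List Letter
  | nil => []
  | node _ L R =>
      (if L = nil then [] else [Letter.a] ++ word L ++ [Letter.aBar]) ++
      (if R = nil then [] else [Letter.b] ++ word R ++ [Letter.bBar])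

/-- The path `u(T)`: keep `ā` (as a north step) and `b̄` (as an east step). -/
def upperPath (T : BinaryTree Unit) : GridPath :=
  (word T).filterMap fun
    | Letter.aBar => some GridStep.N
    | Letter.bBar => some GridStep.E
    | _ => none

/-- The canopy `v(T)`: keep `ā` (as a north step) and `b` (as an east step). It is the interior
canopy of the complete binary tree `T̄`. -/
def canopy (T : BinaryTree Unit) : GridPath :=
  (word T).filterMap fun
    | Letter.aBar => some GridStep.N
    | Letter.b => some GridStep.E
    | _ => none

/-- The right heights of the vertices of `T` in post order, when the root has right height
`h`. -/
def rightHeightsFrom : ℕ → BinaryTree Unit → List ℕ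
  | _, nil => []
  | h, node _ L R => rightHeightsFrom h L ++ rightHeightsFrom (h + 1) R ++ [h]

/-- The right heights (numbers of right edges on the walk from the root) of the vertices of `T`
in post order. -/
def rightHeights (T : BinaryTree Unit) : List ℕ := rightHeightsFrom 0 T

/-- `RightRotation T T'`: the complete binary tree `T'` is obtained from `T` by one right
rotation, at any internal vertex `s` whose left child `t` is internal. -/
inductive RightRotation : BinaryTree Unit → BinaryTree Unit → Prop
  | root (A B C : BinaryTree Unit) :
      RightRotation (node () (node () A B) C) (node () A (node () B C))
  | left {L L' : BinaryTree Unit} (R : BinaryTree Unit) :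
      RightRotation L L' → RightRotation (node () L R) (node () L' R)
  | right (L : BinaryTree Unit) {R R' : BinaryTree Unit} :
      RightRotation R R' → RightRotation (node () L R) (node () L R')

/-- `ValidRightRotation T T'`: the same, where moreover the rotation is valid, that is, the
complete binary tree `B` has more than one vertex (it is not a single external vertex). -/
inductive ValidRightRotation : BinaryTree Unit → BinaryTree Unit → Prop
  | root (A B C : BinaryTree Unit) (hB : B ≠ nil) :
      ValidRightRotation (node () (node () A B) C) (node () A (node () B C))
  | left {L L' : BinaryTree Unit} (R : BinaryTree Unit) :
      ValidRightRotation L L' → ValidRightRotation (node () L R) (node () L' R)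
  | right (L : BinaryTree Unit) {R R' : BinaryTree Unit} :
      ValidRightRotation R R' → ValidRightRotation (node () L R) (node () L R')

/-- The Tamari order on complete binary trees: the reflexive transitive closure of right
rotation. -/
def TamariLE : BinaryTree Unit → BinaryTree Unit → Prop := Relation.ReflTransGen RightRotation

/-- Auxiliary statistic for antisymmetry: the sum over all vertices of the size of the right
subtree. -/
def rightWeight : BinaryTree Unit → ℕ
  | nil => 0
  | node _ L R => rightWeight L + rightWeight R + R.numNodes

theorem RightRotation.numNodes_eq {T T' : BinaryTree Unit} (h : RightRotation T T') :
    T'.numNodes = T.numNodes := by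
  induction h with
  | root A B C => simp; ring
  | left R _ ih => simp [ih]
  | right L _ ih => simp [ih]

theorem RightRotation.rightWeight_lt {T T' : BinaryTree Unit} (h : RightRotation T T') :
    rightWeight T < rightWeight T' := by
  induction h with
  | root A B C => simp [rightWeight]; omega
  | left R _ ih => simp [rightWeight, ih]
  | right L h ih => simp [rightWeight, ih, h.numNodes_eq]

theorem TamariLE.rightWeight_le {T T' : BinaryTree Unit} (h : TamariLE T T') :
    rightWeight T ≤ rightWeight T' := by
  induction h with
  | refl => exact le_rfl
  | tail _ h ih => exact ih.trans h.rightWeight_lt.le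

theorem TamariLE.antisymm {T T' : BinaryTree Unit} (h : TamariLE T T') (h' : TamariLE T' T) :
    T = T' := by
  rcases Relation.ReflTransGen.cases_head h with h | ⟨c, hc, hcb⟩
  · exact h
  · have h1 := hc.rightWeight_lt
    have h2 := TamariLE.rightWeight_le hcb
    have h3 := h'.rightWeight_le
    omega

/-- The complete binary tree `T` has at least one internal vertex and its interior canopy
is `v`. -/
def HasCanopy (v : GridPath) (T : BinaryTree Unit) : Prop := T ≠ nil ∧ canopy T = v

end CanopyTree

/-- The set underlying `I(v)`: the complete binary trees with interior canopy `v`. -/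
def CanopyInterval (v : GridPath) : Type := {T : BinaryTree Unit // CanopyTree.HasCanopy v T}

/-- The order of `I(v)` is the restriction of the Tamari order. -/
instance CanopyInterval.instPartialOrder (v : GridPath) : PartialOrder (CanopyInterval v) where
  le T T' := CanopyTree.TamariLE T.1 T'.1
  le_refl _ := Relation.ReflTransGen.refl
  le_trans _ _ _ := Relation.ReflTransGen.trans
  le_antisymm _ _ h h' := Subtype.ext (h.antisymm h')

/-! ### Signed horizontal distances along a path -/

namespace GridPath

open GridStep

/-! Both posets are compared through integer sequences: the signed distances to `v` along a path
(`heights`) and the right heights of a tree in post-order (`rightHeightsInt`). The letters `b` and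
`b̄` open and close right edges. After any vertex is completed, the excess of east steps in the
canopy over those in the upper path is therefore its right height; this is `heights_upperPath`.

Each sequence determines its object: the descents are the east steps, and a post-order list of right
heights decodes recursively. The sequences ending at `0`, nonnegative and dropping by at most one
per step, are all realised by trees, which gives the bijection. Under it, `TamStep` and
`ValidRightRotation` both become the same move `LiftStep`.

An invalid rotation loses a north step of the canopy, so a Tamari chain between trees with the same
canopy uses valid rotations only; this compares the orders. Covers come from the vectors
`rightSizes`: these increase along the Tamari order, and two rotations of one tree with comparable
vectors coincide. -/

/-- The largest abscissa of a point of `v` in the row `y`. -/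
def rowEnd : GridPath → ℕ → ℕ
  | [], _ => 0
  | E :: v, y => rowEnd v y + 1
  | N :: _, 0 => 0
  | N :: v, y + 1 => rowEnd v y

/-- The signed horizontal distance to `v` of the end of the path `q`. -/
def height (v q : GridPath) : ℤ := rowEnd v (q.count N) - q.count E

/-- The signed horizontal distances to `v` of the points of the path `q ++ u`, from the end
of `q` to the end of `q ++ u`. -/
def heights (v : GridPath) : GridPath → GridPath → List ℤ
  | q, [] => [height v q]
  | q, s :: u => height v q :: heights v (q ++ [s]) u

/-- Rows above the top of `v` receive the abscissa of its end, so no bound on the row is needed. -/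
theorem rowEnd_mono (v : GridPath) : Monotone (rowEnd v) := by
  induction v with
  | nil => intro a b _; simp [rowEnd]
  | cons s v ih =>
    intro a b h
    cases s with
    | E => simpa [rowEnd] using ih h
    | N =>
      cases a with
      | zero => simp [rowEnd]
      | succ a =>
        cases b with
        | zero => omega
        | succ b => exact ih (by omega : a ≤ b)

/-- As `w` does not begin with an east step, the end of `v` is the last point of its row in `v ++
w`. -/
theorem rowEnd_append_count (v w : GridPath) (hw : w.head? ≠ some E) :
    rowEnd (v ++ w) (v.count N) = v.count E := by
  induction v with
  | nil =>
    rcases w with _ | ⟨_ | _, w⟩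
    · simp [rowEnd]
    · simp [rowEnd]
    · simp at hw
  | cons s v ih => cases s <;> simp [rowEnd, ih]

theorem eq_of_rowEnd_eq {v w : GridPath} (hc : v.count N = w.count N)
    (h : ∀ y ≤ v.count N, rowEnd v y = rowEnd w y) : v = w := by
  induction v generalizing w with
  | nil =>
    rcases w with _ | ⟨_ | _, w⟩
    · rfl
    · simp at hc
    · have := h 0 (by simp); simp [rowEnd] at this
  | cons s v ih =>
    cases s with
    | N =>
      rcases w with _ | ⟨_ | _, w⟩
      · simp at hc
      · rw [ih (by simpa using hc) fun y hy => h (y + 1) (by simpa using hy)]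
      · have := h 0 (by simp); simp [rowEnd] at this
    | E =>
      rcases w with _ | ⟨_ | _, w⟩
      · have := h 0 (by simp); simp [rowEnd] at this
      · have := h 0 (by simp); simp [rowEnd] at this
      · rw [ih (by simpa using hc) fun y hy => by
          simpa [rowEnd] using h y (by simpa using hy)]

theorem pointAbove_iff (v : GridPath) (x y : ℕ) :
    PointAbove v (x, y) ↔ y ≤ v.count N ∧ x ≤ rowEnd v y := by
  induction v generalizing x y with
  | nil => simp [PointAbove, points, endpoint, rowEnd]; omega
  | cons s v ih =>
    have key : PointAbove (s :: v) (x, y) ↔ (0 = y ∧ x ≤ 0) ∨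
        ∃ q ∈ points v, q.2 + [s].count N = y ∧ x ≤ q.1 + [s].count E := by
      simp only [PointAbove, points, List.inits_cons, List.map_cons, List.map_map, List.mem_cons,
        List.mem_map, exists_eq_or_imp, endpoint, Function.comp_apply]
      refine or_congr (by simp) ?_
      constructor
      · rintro ⟨_, ⟨l, hl, rfl⟩, h1, h2⟩
        refine ⟨_, ⟨l, hl, rfl⟩, ?_, ?_⟩
        · rw [← h1]; simp [List.count_cons]
        · refine h2.trans (le_of_eq ?_)
          simp [List.count_cons]
      · rintro ⟨_, ⟨l, hl, rfl⟩, h1, h2⟩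
        refine ⟨_, ⟨l, hl, rfl⟩, ?_, ?_⟩
        · rw [← h1]; simp [List.count_cons]
        · refine h2.trans (le_of_eq ?_)
          simp [List.count_cons]
    rw [key]
    cases s with
    | E =>
      -- Truncated subtraction is harmless here: `x ≤ n + 1` and `x - 1 ≤ n` are equivalent even for
      -- `x = 0`.
      have h0 := ih (x - 1) y
      simp only [PointAbove] at h0
      simp only [rowEnd, List.count_cons, List.count_nil]
      simp only [beq_self_eq_true, if_true, reduceCtorEq, beq_iff_eq, if_false, add_zero, zero_add]
      have h1 : (∃ q ∈ points v, q.2 = y ∧ x ≤ q.1 + 1) ↔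
          ∃ q ∈ points v, q.2 = y ∧ x - 1 ≤ q.1 := by
        refine exists_congr fun q => and_congr_right fun _ => and_congr_right fun _ => by omega
      rw [h1, h0]
      omega
    | N =>
      simp only [List.count_cons, List.count_nil]
      simp only [beq_self_eq_true, if_true, reduceCtorEq, beq_iff_eq, if_false, add_zero, zero_add]
      cases y with
      | zero => simp [rowEnd]
      | succ y =>
        have h0 := ih x y
        simp only [PointAbove] at h0
        simpa [rowEnd] using h0

theorem horiz_eq (v : GridPath) (x y : ℕ) (hy : y ≤ v.count N) (hx : x ≤ rowEnd v y) :
    horiz v (x, y) = rowEnd v y - x := by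
  have : {k : ℕ | ∀ j ≤ k, PointAbove v (x + j, y)} = Set.Iic (rowEnd v y - x) := by
    ext k
    simp only [pointAbove_iff, Set.mem_ofPred_eq, Set.mem_Iic]
    constructor
    · intro h
      have := h k le_rfl
      omega
    · intro h j hj
      omega
  simp only [horiz, this, csSup_Iic]

theorem isAbove_iff (v u : GridPath) :
    IsAbove v u ↔ endpoint u = endpoint v ∧ ∀ p, p <+: u → 0 ≤ height v p := by
  refine and_congr_right fun he => ?_
  simp only [points, List.mem_map, List.mem_inits, forall_exists_index, and_imp,
    forall_apply_eq_imp_iff₂, endpoint, pointAbove_iff, height]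
  refine forall₂_congr fun p hp => ?_
  have : p.count N ≤ v.count N := by
    have h1 : u.count N = v.count N := congrArg Prod.snd he
    exact h1 ▸ hp.sublist.count_le N
  omega

theorem IsAbove.horiz_eq_height {v u p : GridPath} (h : IsAbove v u) (hp : p <+: u) :
    (horiz v (endpoint p) : ℤ) = height v p := by
  have h0 := ((isAbove_iff v u).1 h).2 p hp
  have h1 : u.count N = v.count N := congrArg Prod.snd h.1
  have h2 := hp.sublist.count_le N
  simp only [height] at h0 ⊢
  rw [endpoint, horiz_eq v _ _ (by omega) (by omega)]
  omega

theorem height_snoc_E (v q : GridPath) : height v (q ++ [E]) = height v q - 1 := by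
  simp [height]; ring

theorem height_snoc_N (v q : GridPath) : height v q ≤ height v (q ++ [N]) := by
  have := rowEnd_mono v (Nat.le_succ (q.count N))
  simp [height]
  exact this

theorem height_le_snoc (v q : GridPath) (s : GridStep) :
    height v q ≤ height v (q ++ [s]) + 1 := by
  cases s
  · have := height_snoc_N v q; omega
  · rw [height_snoc_E]; omega

/-- Rows end further and further to the right, so the distance drops only on east steps. The steps
can thus be read off from the values without knowing `v`. -/
theorem eq_E_iff_height (v q : GridPath) (s : GridStep) :
    s = E ↔ height v (q ++ [s]) < height v q := by
  cases s
  · simpa using height_snoc_N v q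
  · simp [height_snoc_E]

theorem heights_ne_nil (v q u : GridPath) : heights v q u ≠ [] := by
  cases u <;> simp [heights]

theorem heights_append_cons (v q a : GridPath) (s : GridStep) (b : GridPath) :
    heights v q (a ++ s :: b) = heights v q a ++ heights v (q ++ a ++ [s]) b := by
  induction a generalizing q with
  | nil => simp [heights]
  | cons t a ih => simp [heights, ih]

theorem heights_eq_map (v q u : GridPath) :
    heights v q u = u.inits.map fun p => height v (q ++ p) := by
  induction u generalizing q with
  | nil => simp [heights]
  | cons s u ih => simp [heights, ih, Function.comp_def]

/-- Needed when `D` is travelled before rather than after the exchanged east step: its points move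
one unit left. -/
theorem heights_shift (v q q' u : GridPath) (k : ℕ) (hN : q.count N = q'.count N)
    (hE : q'.count E = q.count E + k) :
    heights v q u = (heights v q' u).map (· + (k : ℤ)) := by
  simp only [heights_eq_map, List.map_map, Function.comp_def, height, List.count_append, hN, hE]
  refine List.map_congr_left fun p _ => ?_
  push_cast
  ring

theorem heights_congr (v q q' u : GridPath) (hN : q.count N = q'.count N)
    (hE : q.count E = q'.count E) : heights v q u = heights v q' u := by
  simpa using heights_shift v q q' u 0 hN hE.symm

theorem heights_eq_concat (v q u : GridPath) :
    ∃ l, heights v q u = l ++ [height v (q ++ u)] := by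
  induction u generalizing q with
  | nil => exact ⟨[], by simp [heights]⟩
  | cons s u ih =>
    obtain ⟨l, hl⟩ := ih (q ++ [s])
    exact ⟨height v q :: l, by simp [heights, hl]⟩

theorem heights_eq_cons (v q u : GridPath) :
    ∃ l, heights v q u = height v q :: l := by
  cases u <;> simp [heights]

theorem heights_split {v q u : GridPath} {l m : List ℤ} {y : ℤ} (hl : l ≠ [])
    (h : heights v q u = l ++ y :: m) :
    ∃ u₁ s u₂, u = u₁ ++ s :: u₂ ∧ heights v q u₁ = l ∧
      heights v (q ++ u₁ ++ [s]) u₂ = y :: m := by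
  induction u generalizing q l with
  | nil =>
    rcases l with _ | ⟨a, l⟩
    · exact absurd rfl hl
    · simp [heights] at h
  | cons s u ih =>
    rcases l with _ | ⟨a, _ | ⟨b, l⟩⟩
    · exact absurd rfl hl
    · simp only [heights, List.cons_append, List.nil_append, List.cons.injEq] at h
      exact ⟨[], s, u, rfl, by simp [heights, h.1], by simpa using h.2⟩
    · simp only [heights, List.cons_append, List.cons.injEq] at h
      obtain ⟨u₁, t, u₂, rfl, h1, h2⟩ := ih (List.cons_ne_nil b l) h.2
      exact ⟨s :: u₁, t, u₂, rfl, by simp [heights, h.1, h1], by simpa using h2⟩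

/-- The signed distances determine the steps of a path. -/
theorem heights_injective {v w q r u u' : GridPath} (h : heights v q u = heights w r u') :
    u = u' := by
  induction u generalizing q r u' with
  | nil =>
    cases u' with
    | nil => rfl
    | cons s u' => simp [heights, heights_ne_nil, eq_comm] at h
  | cons s u ih =>
    cases u' with
    | nil => simp [heights, heights_ne_nil] at h
    | cons t u' =>
      simp only [heights, List.cons.injEq] at h
      obtain ⟨h1, h2⟩ := h
      obtain rfl := ih h2
      obtain ⟨l, hl⟩ := heights_eq_cons v (q ++ [s]) u
      obtain ⟨m, hm⟩ := heights_eq_cons w (r ++ [t]) u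
      rw [hl, hm, List.cons.injEq] at h2
      have hs := eq_E_iff_height v q s
      have ht := eq_E_iff_height w r t
      rw [h1, h2.1, ← ht] at hs
      cases s <;> cases t <;> simp_all

theorem exists_prefix_count (u : GridPath) (y : ℕ) (hy : y ≤ u.count N) :
    ∃ p, p <+: u ∧ p.count N = y := by
  induction u generalizing y with
  | nil => exact ⟨[], by simp, by simpa [eq_comm] using hy⟩
  | cons s u ih =>
    cases y with
    | zero => exact ⟨[], by simp, by simp⟩
    | succ y =>
      cases s with
      | N =>
        obtain ⟨p, hp, hc⟩ := ih y (by simpa using hy)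
        exact ⟨N :: p, by simpa using hp, by simpa using hc⟩
      | E =>
        obtain ⟨p, hp, hc⟩ := ih (y + 1) (by simpa using hy)
        exact ⟨E :: p, by simpa using hp, by simpa using hc⟩

/-- `u` meets every row, and there the abscissa plus the signed distance is the end of the row. -/
theorem eq_of_heights_eq {v w u : GridPath} (hv : u.count N = v.count N)
    (hw : u.count N = w.count N) (h : heights v [] u = heights w [] u) : v = w := by
  refine eq_of_rowEnd_eq (hv.symm.trans hw) fun y hy => ?_
  obtain ⟨p, hp, rfl⟩ := exists_prefix_count u y (hv ▸ hy)
  rw [heights_eq_map, heights_eq_map, List.map_inj_left] at h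
  have := h p (by simpa using hp)
  simpa [height] using this

/-! ### Elementary relations as moves on sequences of distances -/

/-- The effect of an elementary relation on signed distances: a factor running from a value `c`
to the next later value `c` is replaced by its translate, shifted by one position. -/
def LiftStep (l l' : List ℤ) : Prop :=
  ∃ A c D B, (∀ x ∈ D, c < x) ∧ l = A ++ [c + 1] ++ [c] ++ D ++ [c] ++ B ∧
    l' = A ++ [c + 1] ++ (D ++ [c]).map (· + 1) ++ [c] ++ B

/-- A discrete intermediate value argument: the values drop by at most one at a time, so they cannot
pass below `c` without taking it. -/
theorem heights_gt {v q u : GridPath} {c : ℤ} (h0 : c < height v q)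
    (h : ∀ x ∈ heights v q u, x ≠ c) : ∀ x ∈ heights v q u, c < x := by
  induction u generalizing q with
  | nil => simpa [heights] using h0
  | cons s u ih =>
    simp only [heights, List.mem_cons, forall_eq_or_imp] at h ⊢
    refine ⟨h0, ih ?_ h.2⟩
    obtain ⟨l, hl⟩ := heights_eq_cons v (q ++ [s]) u
    have h1 := h.2 (height v (q ++ [s])) (by simp [hl])
    have h2 := height_le_snoc v q s
    omega

/-- The end of `D` is also the start of `S`; the `tail` prevents its value from being listed twice.
-/
theorem heights_exchange (v P D S : GridPath) :
    ∃ A, heights v [] (P ++ [E] ++ (N :: D) ++ S) =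
        A ++ [height v (P ++ [E]) + 1] ++ [height v (P ++ [E])] ++
          heights v (P ++ [E] ++ [N]) D ++ (heights v (P ++ [E] ++ (N :: D)) S).tail ∧
      heights v [] (P ++ (N :: D) ++ [E] ++ S) =
        A ++ [height v (P ++ [E]) + 1] ++ (heights v (P ++ [E] ++ [N]) D).map (· + 1) ++
          heights v (P ++ [E] ++ (N :: D)) S := by
  obtain ⟨A, hA⟩ := heights_eq_concat v [] P
  refine ⟨A, ?_, ?_⟩
  · have e1 : P ++ [E] ++ (N :: D) ++ S = P ++ E :: ([] ++ N :: (D ++ S)) := by simp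
    rw [e1, heights_append_cons, heights_append_cons, hA, height_snoc_E]
    have : heights v ([] ++ P ++ [E] ++ [] ++ [N]) (D ++ S) =
        heights v (P ++ [E] ++ [N]) D ++ (heights v (P ++ [E] ++ (N :: D)) S).tail := by
      cases S with
      | nil => simp [heights]
      | cons t S => rw [heights_append_cons]; simp [heights]
    rw [this]
    simp [heights, height_snoc_E]
  · have e1 : P ++ (N :: D) ++ [E] ++ S = P ++ N :: (D ++ E :: S) := by simp
    rw [e1, heights_append_cons, heights_append_cons, hA, height_snoc_E]
    rw [heights_shift v ([] ++ P ++ [N]) (P ++ [E] ++ [N]) D 1 (by simp) (by simp),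
      heights_congr v ([] ++ P ++ [N] ++ D ++ [E]) (P ++ [E] ++ (N :: D)) S
        (by simp) (by simp)]
    simp

theorem TamStep.liftStep {v u u' : GridPath} (hu : IsAbove v u) (h : TamStep v u u') :
    LiftStep (heights v [] u) (heights v [] u') := by
  obtain ⟨P, D, S, rfl, rfl, hD, hc, hlt⟩ := h
  have hz : ∀ D', D' <+: D →
      (horiz v (endpoint (P ++ [E] ++ D')) : ℤ) = height v (P ++ [E] ++ D') :=
    fun D' hD' => hu.horiz_eq_height
      (((List.prefix_append_right_inj _).2 hD').trans (List.prefix_append _ _))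
  have hz0 : (horiz v (endpoint (P ++ [E])) : ℤ) = height v (P ++ [E]) := by
    simpa using hz [] (by simp)
  obtain ⟨D, rfl⟩ : ∃ D₀, D = N :: D₀ := by
    cases D <;> simp_all
  have hc' : height v (P ++ [E] ++ N :: D) = height v (P ++ [E]) := by
    rw [← hz _ List.prefix_rfl, ← hz0, hc]
  have hne : ∀ D', D' <+: D → D' ≠ D →
      height v (P ++ [E] ++ [N] ++ D') ≠ height v (P ++ [E]) := by
    intro D' h1 h2
    have h3 : N :: D' <+: N :: D := by simpa using h1
    have := hlt (N :: D') h3 (by simp) (by simpa using h2)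
    have h4 := hz _ h3
    rw [← hz0]
    simp only [List.append_assoc, List.cons_append, List.nil_append] at this h4 ⊢
    rw [← h4]
    exact_mod_cast this
  -- The minimality of `p'` only says that the intermediate values differ from that of `p`. They
  -- exceed it because the first step of `D` is north.
  obtain ⟨L, hL, hgt⟩ : ∃ L, heights v (P ++ [E] ++ [N]) D = L ++ [height v (P ++ [E])] ∧
      ∀ x ∈ L, height v (P ++ [E]) < x := by
    rcases List.eq_nil_or_concat D with rfl | ⟨D, s, rfl⟩
    · exact ⟨[], by simpa [heights] using hc', by simp⟩
    · refine ⟨heights v (P ++ [E] ++ [N]) D, ?_, heights_gt ?_ ?_⟩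
      · rw [List.concat_eq_append, heights_append_cons]
        simpa [heights] using hc'
      · refine lt_of_le_of_ne (height_snoc_N _ _) fun h => ?_
        exact hne [] (by simp) (by simp) (by simpa using h.symm)
      · intro x hx
        rw [heights_eq_map] at hx
        simp only [List.mem_map, List.mem_inits] at hx
        obtain ⟨p, hp, rfl⟩ := hx
        refine hne p ?_ ?_
        · exact hp.trans (by simp)
        · rintro rfl
          simpa using hp.length_le
  obtain ⟨A, h1, h2⟩ := heights_exchange v P D S
  obtain ⟨B, hB⟩ := heights_eq_cons v (P ++ [E] ++ N :: D) S
  rw [hc'] at hB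
  refine ⟨A, height v (P ++ [E]), L, B, hgt, ?_, ?_⟩
  · rw [h1, hL, hB]; simp
  · rw [h2, hL, hB]; simp

theorem LiftStep.exists_tamStep {v u : GridPath} {l : List ℤ} (hu : IsAbove v u)
    (h : LiftStep (heights v [] u) l) : ∃ u', TamStep v u u' ∧ heights v [] u' = l := by
  obtain ⟨A, c, L, B, hL, h1, rfl⟩ := h
  have h1' : heights v [] u = (A ++ [c + 1]) ++ c :: (L ++ [c] ++ B) := by simp [h1]
  obtain ⟨P, s, w, rfl, hP, hw⟩ := heights_split (by simp) h1'
  have hw' : heights v ([] ++ P ++ [s]) w = (c :: L) ++ c :: B := by rw [hw]; simp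
  obtain ⟨D₁, t, S, rfl, hD, hS⟩ := heights_split (by simp) hw'
  simp only [List.nil_append] at hD hS hw
  have hPs : height v (P ++ [s]) = c := by
    obtain ⟨l, hl⟩ := heights_eq_cons v (P ++ [s]) D₁
    rw [hl] at hD
    exact (List.cons.inj hD).1
  have hP' : height v P = c + 1 := by
    obtain ⟨l, hl⟩ := heights_eq_concat v [] P
    rw [hl] at hP
    simpa using (List.append_inj' hP rfl).2
  obtain rfl : s = E := (eq_E_iff_height v P s).2 (by omega)
  have hend : height v (P ++ [E] ++ D₁ ++ [t]) = c := by
    obtain ⟨l, hl⟩ := heights_eq_cons v (P ++ [E] ++ D₁ ++ [t]) S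
    rw [hl] at hS
    exact (List.cons.inj hS).1
  -- The factor begins with a north step because the value following the first `c` is not below `c`.
  obtain ⟨D, hDt, hLD⟩ : ∃ D, D₁ ++ [t] = N :: D ∧
      heights v (P ++ [E] ++ [N]) D = L ++ [c] := by
    cases D₁ with
    | nil =>
      have : t ≠ E := fun h => by
        have := (eq_E_iff_height v (P ++ [E]) t).1 h
        simp only [List.append_nil] at hend
        omega
      obtain rfl : t = N := by cases t <;> simp_all
      simp only [heights, List.cons.injEq] at hD
      refine ⟨[], rfl, ?_⟩
      rw [← hD.2]
      simpa [heights] using hend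
    | cons r D₁ =>
      simp only [heights, List.cons.injEq] at hD
      have : r ≠ E := fun h => by
        have h2 := (eq_E_iff_height v (P ++ [E]) r).1 h
        obtain ⟨l, hl⟩ := heights_eq_cons v (P ++ [E] ++ [r]) D₁
        have := hL (height v (P ++ [E] ++ [r])) (by rw [← hD.2, hl]; simp)
        omega
      obtain rfl : r = N := by cases r <;> simp_all
      refine ⟨D₁ ++ [t], rfl, ?_⟩
      rw [heights_append_cons, hD.2]
      simpa [heights] using hend
  have e1 : P ++ E :: (D₁ ++ t :: S) = P ++ [E] ++ (D₁ ++ [t]) ++ S := by simp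
  have hz : ∀ D', D' <+: D₁ ++ [t] →
      (horiz v (endpoint (P ++ [E] ++ D')) : ℤ) = height v (P ++ [E] ++ D') := fun D' hD' => by
    refine hu.horiz_eq_height ?_
    rw [e1]
    exact ((List.prefix_append_right_inj _).2 hD').trans (List.prefix_append _ _)
  have hz0 : (horiz v (endpoint (P ++ [E])) : ℤ) = c := by
    rw [← hPs]; simpa using hz [] (by simp)
  refine ⟨P ++ (D₁ ++ [t]) ++ [E] ++ S, ⟨P, D₁ ++ [t], S, e1, rfl, by simp [hDt], ?_, ?_⟩, ?_⟩
  · have := hz _ List.prefix_rfl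
    rw [← List.append_assoc, hend, ← hz0] at this
    rw [← List.append_assoc]
    exact_mod_cast this
  · intro D' hD' hne hne'
    have h3 := hz _ hD'
    have h4 : D' <+: D₁ := by
      rw [List.prefix_concat_iff] at hD'
      exact hD'.resolve_left hne'
    have h5 : c < height v (P ++ [E] ++ D') := by
      refine hL _ ?_
      rw [heights_eq_map] at hD
      cases D₁ with
      | nil => simp at h4; exact absurd h4 hne
      | cons r D₁ =>
        simp only [List.inits_cons, List.map_cons, List.cons.injEq] at hD
        rw [← hD.2]
        rcases D' with _ | ⟨r', D'⟩
        · exact absurd rfl hne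
        · simp only [List.cons_prefix_cons] at h4
          obtain ⟨rfl, h4⟩ := h4
          simp only [List.mem_map, List.mem_inits]
          exact ⟨_, ⟨D', h4, rfl⟩, rfl⟩
    intro h6
    rw [h6, hz0] at h3
    omega
  · obtain ⟨A', h3, h4⟩ := heights_exchange v P D S
    rw [hDt, h4, hPs, hLD]
    obtain ⟨l, hl⟩ := heights_eq_concat v [] P
    have e2 : P ++ [E] ++ D₁ ++ [t] = P ++ [E] ++ N :: D := by simp [← hDt]
    rw [e2] at hS
    rw [hS]
    have h5 : heights v [] (P ++ [E] ++ (N :: D) ++ S) = A ++ [c + 1] ++ [c] ++ L ++ [c] ++ B := by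
      rw [← h1, e1, hDt]
    rw [h3, hLD, hS, hPs] at h5
    simp only [List.append_assoc, List.tail_cons] at h5
    rw [List.append_cancel_right h5]
    simp

end GridPath

/-! ### Right heights of binary trees -/

namespace CanopyTree

open BinaryTree GridStep GridPath

/-- Integer-valued version of `rightHeightsFrom`. -/
def rightHeightsInt : ℤ → BinaryTree Unit → List ℤ
  | _, nil => []
  | d, node _ L R => rightHeightsInt d L ++ rightHeightsInt (d + 1) R ++ [d]

theorem rightHeightsInt_natCast (d : ℕ) (T : BinaryTree Unit) :
    rightHeightsInt d T = (rightHeightsFrom d T).map Nat.cast := by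
  induction T generalizing d with
  | nil => rfl
  | node _ L R ihL ihR =>
    have := ihR (d + 1)
    push_cast at this
    simp [rightHeightsInt, rightHeightsFrom, ihL, this]

theorem le_of_mem_rightHeightsInt {d : ℤ} {T : BinaryTree Unit} {x : ℤ}
    (hx : x ∈ rightHeightsInt d T) : d ≤ x := by
  induction T generalizing d with
  | nil => simp [rightHeightsInt] at hx
  | node _ L R ihL ihR =>
    simp only [rightHeightsInt, List.mem_append, List.mem_singleton] at hx
    rcases hx with (hx | hx) | hx
    · exact ihL hx
    · have := ihR hx; omega
    · exact hx.ge

theorem rightHeightsInt_eq_nil {d : ℤ} {T : BinaryTree Unit} :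
    rightHeightsInt d T = [] ↔ T = nil := by
  cases T <;> simp [rightHeightsInt]

/-- A list whose elements split at the last value equal to `d` splits uniquely. -/
theorem append_inj_of_lt {d : ℤ} {X X' Y Y' : List ℤ} (hX : X = [] ∨ ∃ Z, X = Z ++ [d])
    (hX' : X' = [] ∨ ∃ Z, X' = Z ++ [d]) (hY : ∀ y ∈ Y, d < y) (hY' : ∀ y ∈ Y', d < y)
    (h : X ++ Y = X' ++ Y') : X = X' ∧ Y = Y' := by
  -- A nonempty overlap `a` would end in `d`, as a suffix of `X'`, and in a value above `d`, as part
  -- of `Y`.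
  have key : ∀ {X X' Y Y' : List ℤ}, (X' = [] ∨ ∃ Z, X' = Z ++ [d]) → (∀ y ∈ Y, d < y) →
      ∀ a, X' = X ++ a → Y = a ++ Y' → a = [] := by
    intro X X' Y Y' hX' hY a h1 h2
    rcases List.eq_nil_or_concat a with rfl | ⟨a, b, rfl⟩
    · rfl
    · exfalso
      rcases hX' with rfl | ⟨Z, rfl⟩
      · simp at h1
      · rw [List.concat_eq_append, ← List.append_assoc] at h1
        have hb := (List.append_inj' h1 rfl).2
        have := hY b (by simp [h2])
        simp at hb
        omega
  rcases List.append_eq_append_iff.1 h with ⟨a, h1, h2⟩ | ⟨a, h1, h2⟩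
  · obtain rfl := key hX' hY a h1 h2
    simp_all
  · obtain rfl := key hX hY' a h1 h2
    simp_all

theorem rightHeightsInt_eq_nil_or_concat (d : ℤ) (T : BinaryTree Unit) :
    rightHeightsInt d T = [] ∨ ∃ Z, rightHeightsInt d T = Z ++ [d] := by
  cases T with
  | nil => exact Or.inl rfl
  | node _ L R => exact Or.inr ⟨_, rfl⟩

theorem lt_of_mem_rightHeightsInt_succ {d : ℤ} {T : BinaryTree Unit} :
    ∀ x ∈ rightHeightsInt (d + 1) T, d < x := fun x hx => by
  have := le_of_mem_rightHeightsInt hx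
  omega

/-- Once the root is removed, the last `d` is the root of the left subtree, and all values of the
right subtree exceed `d`. This locates the boundary between the two. -/
theorem rightHeightsInt_injective {d : ℤ} {T S : BinaryTree Unit}
    (h : rightHeightsInt d T = rightHeightsInt d S) : T = S := by
  induction T generalizing d S with
  | nil => exact (rightHeightsInt_eq_nil.1 h.symm).symm
  | node _ L R ihL ihR =>
    cases S with
    | nil => simp [rightHeightsInt] at h
    | node _ L' R' =>
      obtain ⟨h1, h2⟩ := append_inj_of_lt (rightHeightsInt_eq_nil_or_concat d L)
        (rightHeightsInt_eq_nil_or_concat d L') lt_of_mem_rightHeightsInt_succ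
        lt_of_mem_rightHeightsInt_succ (List.append_cancel_right h)
      rw [ihL h1, ihR h2]

/-- The new value is a new leaf, first in post-order, attached on the walk from the root to the
present first vertex. The default `d - 1` makes the bound force `x = d` for the empty tree. -/
theorem exists_rightHeightsInt_cons (T : BinaryTree Unit) (d x : ℤ) (hx : d ≤ x)
    (hT : x ≤ (rightHeightsInt d T).headD (d - 1) + 1) :
    ∃ T', rightHeightsInt d T' = x :: rightHeightsInt d T := by
  induction T generalizing d with
  | nil =>
    refine ⟨node () nil nil, ?_⟩
    simp [rightHeightsInt] at hT ⊢
    omega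
  | node _ L R ihL ihR =>
    by_cases hL : L = nil
    · subst hL
      rcases hx.eq_or_lt with rfl | hlt
      · exact ⟨node () (node () nil nil) R, by simp [rightHeightsInt]⟩
      · obtain ⟨R', hR'⟩ := ihR (d + 1) hlt (by
          cases hR : rightHeightsInt (d + 1) R <;> simp_all [rightHeightsInt])
        exact ⟨node () nil R', by simp [rightHeightsInt, hR']⟩
    · obtain ⟨L', hL'⟩ := ihL d hx (by
        rw [← rightHeightsInt_eq_nil (d := d)] at hL
        cases hl : rightHeightsInt d L <;> simp_all [rightHeightsInt])
      exact ⟨node () L' R, by simp [rightHeightsInt, hL']⟩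

theorem exists_rightHeightsInt_eq_heights (v q u : GridPath)
    (h0 : ∀ x ∈ heights v q u, 0 ≤ x) (hend : height v (q ++ u) = 0) :
    ∃ T, rightHeightsInt 0 T = heights v q u := by
  induction u generalizing q with
  | nil => exact ⟨node () nil nil, by simpa [rightHeightsInt, heights] using hend.symm⟩
  | cons s u ih =>
    simp only [heights, List.mem_cons, forall_eq_or_imp] at h0
    obtain ⟨T, hT⟩ := ih (q ++ [s]) h0.2 (by simpa using hend)
    obtain ⟨T', hT'⟩ := exists_rightHeightsInt_cons T 0 (height v q) h0.1 (by
      obtain ⟨l, hl⟩ := heights_eq_cons v (q ++ [s]) u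
      rw [hT, hl]
      exact height_le_snoc v q s)
    exact ⟨T', by rw [hT', hT, heights]⟩

/-! ### Upper path and canopy of a tree -/

theorem upperPath_node (L R : BinaryTree Unit) : upperPath (node () L R) =
    (if L = nil then [] else upperPath L ++ [N]) ++
      (if R = nil then [] else upperPath R ++ [E]) := by
  simp only [upperPath, word]
  split_ifs <;> simp

theorem canopy_node (L R : BinaryTree Unit) : canopy (node () L R) =
    (if L = nil then [] else canopy L ++ [N]) ++
      (if R = nil then [] else E :: canopy R) := by
  simp only [canopy, word]
  split_ifs <;> simp

theorem count_upperPath (T : BinaryTree Unit) (s : GridStep) :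
    (upperPath T).count s = (canopy T).count s := by
  induction T with
  | nil => rfl
  | node _ L R ihL ihR =>
    rw [upperPath_node, canopy_node]
    split_ifs <;> simp [ihL, ihR, List.count_cons]

/-- Here `v` and `w` stand for the canopy read before and after the subtree `T`, `q` for the upper
path read before it, and `d` for the number of right edges still open. A completed subtree is never
followed at once by `b` in the canopy, whence `hw`. -/
theorem height_append_upperPath (T : BinaryTree Unit) (v w q : GridPath) (d : ℤ)
    (hw : w.head? ≠ some E) (hN : q.count N = v.count N) (hE : (q.count E : ℤ) + d = v.count E) :
    GridPath.height (v ++ canopy T ++ w) (q ++ upperPath T) = d := by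
  have h1 : (q ++ upperPath T).count N = (v ++ canopy T).count N := by
    simp [count_upperPath, hN]
  have h2 : (q ++ upperPath T).count E = q.count E + (canopy T).count E := by
    simp [count_upperPath]
  rw [GridPath.height, h1, h2, rowEnd_append_count _ _ hw, List.count_append]
  push_cast
  omega

/-- The signed distances along the part of a path contributed by a subtree whose root has right
height `d` are the right heights of this subtree. -/
theorem heights_upperPath (T : BinaryTree Unit) (hT : T ≠ nil) (v w q : GridPath) (d : ℤ)
    (hw : w.head? ≠ some E) (hN : q.count N = v.count N) (hE : (q.count E : ℤ) + d = v.count E) :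
    heights (v ++ canopy T ++ w) q (upperPath T) = rightHeightsInt d T := by
  induction T generalizing v w q d with
  | nil => exact absurd rfl hT
  | node _ L R ihL ihR =>
    have hr := height_append_upperPath (node () L R) v w q d hw hN hE
    rw [upperPath_node, canopy_node] at hr ⊢
    have cN := count_upperPath L N
    have cE := count_upperPath L E
    by_cases hL : L = nil <;> by_cases hR : R = nil
    · simp only [hL, hR, if_true, List.append_nil] at hr ⊢
      simp [heights, hr, rightHeightsInt]
    · have h2 := ihR hR (v ++ [E]) w q (d + 1) hw (by simp [hN]) (by simp; omega)
      simp only [hL, hR, if_true, if_false, List.nil_append] at hr ⊢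
      rw [heights_append_cons]
      simp only [List.append_assoc, List.cons_append, List.nil_append] at hr h2 ⊢
      simp [heights, h2, hr, rightHeightsInt]
    · have h1 := ihL hL v (N :: w) q d (by simp) hN hE
      simp only [hL, hR, if_true, if_false, List.append_nil] at hr ⊢
      rw [heights_append_cons]
      simp only [List.append_assoc, List.cons_append, List.nil_append] at hr h1 ⊢
      simp [heights, h1, hr, rightHeightsInt]
    · have h1 := ihL hL v (N :: E :: (canopy R ++ w)) q d (by simp) hN hE
      -- Before the right subtree the canopy has read `N` and `E`, the upper path only `N`; hence `d
      -- + 1`.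
      have h2 := ihR hR (v ++ canopy L ++ [N, E]) w (q ++ upperPath L ++ [N]) (d + 1) hw
        (by simp [hN, cN]) (by simp [cE]; omega)
      simp only [hL, hR, if_false] at hr ⊢
      have e : upperPath L ++ [N] ++ (upperPath R ++ [E]) =
          upperPath L ++ N :: (upperPath R ++ E :: []) := by simp
      rw [e] at hr ⊢
      rw [heights_append_cons, heights_append_cons]
      simp only [List.append_assoc, List.cons_append, List.nil_append] at hr h1 h2 ⊢
      simp [heights, h1, h2, hr, rightHeightsInt]

theorem HasCanopy.heights_eq {v : GridPath} {T : BinaryTree Unit} (h : HasCanopy v T) :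
    heights v [] (upperPath T) = rightHeightsInt 0 T := by
  have := heights_upperPath T h.1 [] [] [] 0 (by simp) rfl (by simp)
  simpa [h.2] using this

theorem HasCanopy.isAbove {v : GridPath} {T : BinaryTree Unit} (h : HasCanopy v T) :
    IsAbove v (upperPath T) := by
  refine (isAbove_iff _ _).2 ⟨by simp [endpoint, count_upperPath, h.2], fun p hp => ?_⟩
  have h1 := h.heights_eq
  rw [heights_eq_map] at h1
  refine le_of_mem_rightHeightsInt (T := T) ?_
  rw [← h1]
  simpa using ⟨p, hp, rfl⟩

theorem HasCanopy.rightHeights_eq {v : GridPath} {T : BinaryTree Unit} (h : HasCanopy v T) :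
    rightHeights T = (points (upperPath T)).map (horiz v) := by
  apply List.map_injective_iff.2 (Nat.cast_injective (R := ℤ))
  rw [rightHeights, ← rightHeightsInt_natCast, Nat.cast_zero, ← h.heights_eq, heights_eq_map]
  simp only [points, List.map_map, List.nil_append]
  refine List.map_congr_left fun p hp => ?_
  exact (h.isAbove.horiz_eq_height ((List.mem_inits _ _).1 hp)).symm

theorem HasCanopy.upperPath_injective {v : GridPath} {T S : BinaryTree Unit}
    (hT : HasCanopy v T) (hS : HasCanopy v S) (h : upperPath T = upperPath S) : T = S := by
  refine rightHeightsInt_injective (d := 0) ?_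
  rw [← hT.heights_eq, ← hS.heights_eq, h]

theorem exists_upperPath_eq {v u : GridPath} (hu : IsAbove v u) :
    ∃ T, HasCanopy v T ∧ upperPath T = u := by
  have hu' := (isAbove_iff v u).1 hu
  have hcE : u.count E = v.count E := congrArg Prod.fst hu.1
  have hcN : u.count N = v.count N := congrArg Prod.snd hu.1
  obtain ⟨T, hT⟩ := exists_rightHeightsInt_eq_heights v [] u
    (by simpa [heights_eq_map] using hu'.2) (by
      have := rowEnd_append_count v [] (by simp)
      simp only [List.append_nil] at this
      simp [GridPath.height, hcE, hcN, this])
  have hne : T ≠ nil := by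
    rintro rfl
    exact heights_ne_nil v [] u hT.symm
  have hc : HasCanopy (canopy T) T := ⟨hne, rfl⟩
  have h1 := hc.heights_eq.trans hT
  have h2 := heights_injective h1
  -- The same path now has the same distances to `canopy T` and to `v`, which forces these to agree.
  rw [h2] at h1
  refine ⟨T, ⟨hne, ?_⟩, h2⟩
  refine eq_of_heights_eq (u := u) ?_ hcN h1
  rw [← h2, count_upperPath]

/-! ### Valid right rotations -/

theorem rightHeightsInt_add_one (d : ℤ) (T : BinaryTree Unit) :
    rightHeightsInt (d + 1) T = (rightHeightsInt d T).map (· + 1) := by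
  induction T generalizing d with
  | nil => rfl
  | node _ L R ihL ihR => simp [rightHeightsInt, ihL, ihR]

theorem _root_.GridPath.LiftStep.append_right {l l' : List ℤ} (h : LiftStep l l') (m : List ℤ) :
    LiftStep (l ++ m) (l' ++ m) := by
  obtain ⟨A, c, D, B, hD, rfl, rfl⟩ := h
  exact ⟨A, c, D, B ++ m, hD, by simp, by simp⟩

theorem _root_.GridPath.LiftStep.append_left {l l' : List ℤ} (h : LiftStep l l') (m : List ℤ) :
    LiftStep (m ++ l) (m ++ l') := by
  obtain ⟨A, c, D, B, hD, rfl, rfl⟩ := h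
  exact ⟨m ++ A, c, D, B, hD, by simp, by simp⟩

/-- At the root, the lists are those of `A`, `B`, the vertex `d`, `C`, and `d` before; afterwards
`C` and its preceding vertex are raised, the latter moving behind `C`. Validity provides the value
`c + 1` in front: it is the root of `B`. -/
theorem ValidRightRotation.liftStep {T S : BinaryTree Unit} (h : ValidRightRotation T S) (d : ℤ) :
    LiftStep (rightHeightsInt d T) (rightHeightsInt d S) := by
  induction h generalizing d with
  | root A B C hB =>
    obtain ⟨Z, hZ⟩ := (rightHeightsInt_eq_nil_or_concat (d + 1) B).resolve_left
      fun h => hB (rightHeightsInt_eq_nil.1 h)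
    refine ⟨rightHeightsInt d A ++ Z, d, rightHeightsInt (d + 1) C, [],
      lt_of_mem_rightHeightsInt_succ, ?_, ?_⟩
    · simp [rightHeightsInt, hZ]
    · simp [rightHeightsInt, hZ, rightHeightsInt_add_one (d + 1) C]
  | left R _ ih => exact ((ih d).append_right _).append_right _
  | right L _ ih => exact ((ih (d + 1)).append_left _).append_right _

/-- If the factor ends at the root, the rotation is there, and the preceding `c + 1` makes the
middle subtree nonempty. Otherwise the factor lies within `L` or within `R`. If it straddled them,
it would contain the root value `d` of `L`, so `c ≤ d`, while its final `c` would lie in `R`, where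
values exceed `d`. -/
theorem exists_validRightRotation (T : BinaryTree Unit) (d : ℤ) (l : List ℤ)
    (h : LiftStep (rightHeightsInt d T) l) :
    ∃ S, ValidRightRotation T S ∧ rightHeightsInt d S = l := by
  induction T generalizing d l with
  | nil =>
    obtain ⟨A, c, D, B, hD, h, -⟩ := h
    simp [rightHeightsInt] at h
  | node _ L R ihL ihR =>
    obtain ⟨A, c, D, B, hD, h, rfl⟩ := h
    rw [rightHeightsInt] at h
    rcases List.eq_nil_or_concat B with rfl | ⟨B, b, rfl⟩
    · rw [List.append_nil] at h
      obtain ⟨h, h'⟩ := List.append_inj' h rfl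
      obtain rfl : d = c := by simpa using h'
      obtain ⟨hL, hR⟩ := append_inj_of_lt (rightHeightsInt_eq_nil_or_concat d L)
        (Or.inr ⟨A ++ [d + 1], rfl⟩) lt_of_mem_rightHeightsInt_succ hD h
      cases L with
      | nil => simp [rightHeightsInt] at hL
      | node _ L₁ L₂ =>
        have hL' := List.append_cancel_right hL
        have hL₂ : L₂ ≠ nil := by
          rintro rfl
          rcases rightHeightsInt_eq_nil_or_concat d L₁ with h | ⟨Z, h⟩
          · simp [rightHeightsInt, h] at hL'
          · rw [h] at hL'
            simp [rightHeightsInt] at hL'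
        refine ⟨_, ValidRightRotation.root L₁ L₂ R hL₂, ?_⟩
        rw [← hL', ← hR]
        simp [rightHeightsInt, rightHeightsInt_add_one (d + 1) R]
    · rw [List.concat_eq_append, ← List.append_assoc] at h
      obtain ⟨hs, h'⟩ := List.append_inj' h rfl
      obtain rfl : d = b := by simpa using h'
      have inR : ∀ a, A = rightHeightsInt d L ++ a →
          rightHeightsInt (d + 1) R = a ++ [c + 1] ++ [c] ++ D ++ [c] ++ B →
          ∃ S, ValidRightRotation (node () L R) S ∧ rightHeightsInt d S =
            A ++ [c + 1] ++ (D ++ [c]).map (· + 1) ++ [c] ++ B.concat d := by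
        rintro a rfl hR
        obtain ⟨S, h1, h2⟩ := ihR (d + 1) _ ⟨a, c, D, B, hD, hR, rfl⟩
        exact ⟨_, ValidRightRotation.right L h1, by simp [rightHeightsInt, h2]⟩
      rcases List.append_eq_append_iff.1 hs with ⟨a, h1, h2⟩ | ⟨a, h1, h2⟩
      · have h1' : A ++ ([c + 1] ++ [c] ++ D ++ [c]) = rightHeightsInt d L ++ a := by
          simpa using h1
        rcases List.append_eq_append_iff.1 h1' with ⟨e, h3, h4⟩ | ⟨e, h3, h4⟩
        · rcases List.eq_nil_or_concat e with rfl | ⟨e, y, rfl⟩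
          · refine inR [] (by simpa using h3.symm) ?_
            rw [h2, ← (show _ = a from h4)]; simp
          · rw [List.concat_eq_append] at h3 h4
            have hy : y = d := by
              rcases rightHeightsInt_eq_nil_or_concat d L with hL | ⟨Z, hL⟩
              · simp [hL] at h3
              · rw [hL, ← List.append_assoc] at h3
                simpa using (List.append_inj' h3 rfl).2.symm
            have hcd : c ≤ d := by
              have : d ∈ [c + 1] ++ [c] ++ D ++ [c] := by rw [h4]; simp [hy]
              simp only [List.mem_append, List.mem_singleton] at this
              rcases this with ((h | h) | h) | h
              · omega
              · omega
              · exact (hD d h).le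
              · omega
            rcases List.eq_nil_or_concat a with rfl | ⟨a, z, rfl⟩
            · rw [List.append_nil] at h4
              rw [← h4] at h3
              obtain ⟨S, h5, h6⟩ := ihL d _ ⟨A, c, D, [], hD, by simp [h3], rfl⟩
              exact ⟨_, ValidRightRotation.left R h5, by
                rw [rightHeightsInt, h6, h2]; simp⟩
            · rw [List.concat_eq_append, ← List.append_assoc] at h4
              have hz : c = z := by simpa using (List.append_inj' h4 rfl).2
              have : z ∈ rightHeightsInt (d + 1) R := by rw [h2]; simp
              have := le_of_mem_rightHeightsInt this
              omega
        · refine inR e h3 ?_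
          rw [h2, h4]; simp
      · obtain ⟨S, h3, h4⟩ := ihL d _ ⟨A, c, D, a, hD, h1, rfl⟩
        exact ⟨_, ValidRightRotation.left R h3, by simp [rightHeightsInt, h4, h2]⟩

end CanopyTree

/-! ### Right rotations and the canopy -/

namespace CanopyTree

open BinaryTree GridStep GridPath

theorem RightRotation.ne_nil {T T' : BinaryTree Unit} (h : RightRotation T T') :
    T ≠ nil ∧ T' ≠ nil := by
  cases h <;> simp

theorem ValidRightRotation.rightRotation {T T' : BinaryTree Unit} (h : ValidRightRotation T T') :
    RightRotation T T' := by
  induction h with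
  | root A B C _ => exact .root A B C
  | left R _ ih => exact .left R ih
  | right L _ ih => exact .right L ih

theorem ValidRightRotation.canopy_eq {T T' : BinaryTree Unit} (h : ValidRightRotation T T') :
    canopy T' = canopy T := by
  induction h with
  | root A B C hB => simp [canopy_node, hB]
  | left R h ih =>
    simp [canopy_node, ih, h.rightRotation.ne_nil.1, h.rightRotation.ne_nil.2]
  | right L h ih =>
    simp [canopy_node, ih, h.rightRotation.ne_nil.1, h.rightRotation.ne_nil.2]

theorem ValidRightRotation.hasCanopy {v : GridPath} {T T' : BinaryTree Unit}
    (h : ValidRightRotation T T') (hT : HasCanopy v T) : HasCanopy v T' :=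
  ⟨h.rightRotation.ne_nil.2, h.canopy_eq.trans hT.2⟩

/-- When `B` is external, the left edge between the two rotated vertices becomes a right edge, and
nothing replaces its `N`. -/
theorem RightRotation.valid_or_count_lt {T T' : BinaryTree Unit} (h : RightRotation T T') :
    ValidRightRotation T T' ∨ (canopy T').count N < (canopy T).count N := by
  induction h with
  | root A B C =>
    by_cases hB : B = nil
    · right
      subst hB
      by_cases hA : A = nil <;> by_cases hC : C = nil <;> simp [canopy_node, hA, hC]
    · exact Or.inl (.root A B C hB)
  | left R h ih =>
    refine ih.imp (.left R) fun ih => ?_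
    simp [canopy_node, h.ne_nil.1, h.ne_nil.2, ih]
  | right L h ih =>
    refine ih.imp (.right L) fun ih => ?_
    simp [canopy_node, h.ne_nil.1, h.ne_nil.2, ih]

theorem TamariLE.count_canopy_le {T T' : BinaryTree Unit} (h : TamariLE T T') :
    (canopy T').count N ≤ (canopy T).count N := by
  induction h with
  | refl => exact le_rfl
  | tail _ h ih =>
    rcases h.valid_or_count_lt with h | h
    · rw [h.canopy_eq]; exact ih
    · omega

/-! ### Right rotations are covering relations -/

/-- The sizes of the right subtrees of the vertices, in symmetric order. -/
def rightSizes : BinaryTree Unit → List ℕ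
  | nil => []
  | node _ L R => rightSizes L ++ R.numNodes :: rightSizes R

theorem length_rightSizes (T : BinaryTree Unit) : (rightSizes T).length = T.numNodes := by
  induction T with
  | nil => rfl
  | node _ L R ihL ihR => simp [rightSizes, ihL, ihR]; ring

theorem forall₂_append_iff {l₁ l₂ m₁ m₂ : List ℕ} (h : l₁.length = m₁.length) :
    List.Forall₂ (· ≤ ·) (l₁ ++ l₂) (m₁ ++ m₂) ↔
      List.Forall₂ (· ≤ ·) l₁ m₁ ∧ List.Forall₂ (· ≤ ·) l₂ m₂ := by
  refine ⟨fun H => ?_, fun H => List.rel_append H.1 H.2⟩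
  have h1 := List.forall₂_take l₁.length H
  have h2 := List.forall₂_drop l₁.length H
  simp only [List.take_left, List.drop_left] at h1 h2
  rw [h, List.take_left] at h1
  rw [h, List.drop_left] at h2
  exact ⟨h1, h2⟩

/-- Rotation keeps the symmetric order and changes one entry: the right subtree `B` of the lower
vertex grows to `(B, C)`. -/
theorem RightRotation.rightSizes_le {T T' : BinaryTree Unit} (h : RightRotation T T') :
    List.Forall₂ (· ≤ ·) (rightSizes T) (rightSizes T') := by
  have hr : ∀ l : List ℕ, List.Forall₂ (· ≤ ·) l l := fun l => List.forall₂_refl l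
  induction h with
  | root A B C =>
    simp only [rightSizes, List.append_assoc, List.cons_append]
    exact List.rel_append (hr _) (.cons (by simp; omega) (hr _))
  | left R h ih => exact List.rel_append ih (hr _)
  | right L h ih => exact List.rel_append (hr _) (.cons h.numNodes_eq.ge ih)

theorem TamariLE.rightSizes_le {T T' : BinaryTree Unit} (h : TamariLE T T') :
    List.Forall₂ (· ≤ ·) (rightSizes T) (rightSizes T') := by
  induction h with
  | refl => exact List.forall₂_refl _
  | tail _ h ih =>
    exact (List.forall₂_iff_get.2 ⟨ih.length_eq.trans h.rightSizes_le.length_eq,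
      fun i h1 h2 => (ih.get h1 (ih.length_eq ▸ h1)).trans (h.rightSizes_le.get _ h2)⟩)

theorem RightRotation.sum_rightSizes_lt {T T' : BinaryTree Unit} (h : RightRotation T T') :
    (rightSizes T).sum < (rightSizes T').sum := by
  induction h with
  | root A B C => simp [rightSizes]
  | left R h ih => simp [rightSizes, ih]
  | right L h ih => simp [rightSizes, ih, h.numNodes_eq]

theorem RightRotation.not_rightSizes_ge {T T' : BinaryTree Unit} (h : RightRotation T T') :
    ¬ List.Forall₂ (· ≤ ·) (rightSizes T') (rightSizes T) := fun h' =>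
  absurd h'.sum_le_sum (not_le.2 h.sum_rightSizes_lt)

/-- In symmetric order, the right subtree of a vertex consists of vertices that come after it. -/
theorem le_of_rightSizes_eq {T : BinaryTree Unit} {l m : List ℕ} {x : ℕ}
    (h : rightSizes T = l ++ x :: m) : x ≤ m.length := by
  induction T generalizing l m x with
  | nil => simp [rightSizes] at h
  | node _ L R ihL ihR =>
    rw [rightSizes] at h
    have hR := length_rightSizes R
    rcases List.append_eq_append_iff.1 h with ⟨a, h1, h2⟩ | ⟨a, h1, h2⟩
    · cases a with
      | nil => simp at h2; rw [← h2.2]; omega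
      | cons y a =>
        simp at h2
        exact ihR h2.2
    · cases a with
      | nil => simp at h2; rw [h2.2]; omega
      | cons y a =>
        simp at h2
        obtain ⟨rfl, rfl⟩ := h2
        have := ihL h1
        simp
        omega

theorem exists_of_forall₂_append_cons {r : ℕ → ℕ → Prop} {l a b : List ℕ} {y : ℕ}
    (h : List.Forall₂ r l (a ++ y :: b)) :
    ∃ a' x b', l = a' ++ x :: b' ∧ List.Forall₂ r a' a ∧ r x y ∧ List.Forall₂ r b' b := by
  induction a generalizing l with
  | nil =>
    obtain ⟨x, b', h1, h2, rfl⟩ := List.forall₂_cons_right_iff.1 h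
    exact ⟨[], x, b', rfl, .nil, h1, h2⟩
  | cons z a ih =>
    obtain ⟨z', l', h1, h2, rfl⟩ := List.forall₂_cons_right_iff.1 h
    obtain ⟨a', x, b', rfl, h3, h4⟩ := ih h2
    exact ⟨z' :: a', x, b', rfl, .cons h1 h3, h4⟩

/-- Each rotation raises a single entry, so rotations in disjoint places are incomparable. Only a
root rotation against one inside the left subtree needs more, since both may raise the same entry.
-/
theorem RightRotation.eq_of_rightSizes_le {T X Y : BinaryTree Unit} (hX : RightRotation T X)
    (hY : RightRotation T Y) (h : List.Forall₂ (· ≤ ·) (rightSizes X) (rightSizes Y)) :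
    X = Y := by
  have hlen : ∀ {S S' : BinaryTree Unit}, RightRotation S S' →
      (rightSizes S).length = (rightSizes S').length := fun h => h.rightSizes_le.length_eq
  induction hX generalizing Y with
  | root A B C =>
    cases hY with
    | root => rfl
    | @left _ L' _ h' =>
      exfalso
      have e : rightSizes (node () A (node () B C)) =
          (rightSizes A ++ (node () B C).numNodes :: rightSizes B) ++
            C.numNodes :: rightSizes C := by simp [rightSizes]
      have h1 := hlen h'
      rw [e, rightSizes, forall₂_append_iff (by simpa [rightSizes] using h1)] at h
      obtain ⟨a, x, b, h2, -, h3, h4⟩ := exists_of_forall₂_append_cons h.1.flip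
      -- Inside the left subtree this entry stays at most the size of `B`, but the root rotation
      -- raises it beyond that.
      have h5 := le_of_rightSizes_eq h2
      have h6 := h4.length_eq
      rw [length_rightSizes] at h6
      simp only [numNodes] at h3
      omega
    | @right _ _ R' h' =>
      exfalso
      simp only [rightSizes, List.append_assoc, List.cons_append] at h
      rw [forall₂_append_iff rfl] at h
      have := (List.forall₂_cons.1 h.2).1
      simp at this
  | @left L L' R hL ih =>
    cases hY with
    | root A B _ =>
      have e : rightSizes (node () A (node () B R)) =
          (rightSizes A ++ (node () B R).numNodes :: rightSizes B) ++
            R.numNodes :: rightSizes R := by simp [rightSizes]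
      have h1 := hlen hL
      rw [e, rightSizes, forall₂_append_iff (by simpa [rightSizes] using h1.symm)] at h
      obtain ⟨a, x, b, h2, h3, -, h4⟩ := exists_of_forall₂_append_cons h.1
      -- The entry raised by the root rotation is at most the size of `B` in `L'`, so `Y` would
      -- bound `L'` by `L` throughout.
      have h5 := le_of_rightSizes_eq h2
      rw [h4.length_eq, length_rightSizes] at h5
      refine absurd ?_ hL.not_rightSizes_ge
      rw [h2, rightSizes]
      exact List.rel_append h3 (.cons h5 h4)
    | @left _ L'' _ h' =>
      rw [rightSizes, rightSizes, forall₂_append_iff ((hlen hL).symm.trans (hlen h'))] at h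
      rw [ih h' h.1]
    | @right _ _ R' h' =>
      rw [rightSizes, rightSizes, forall₂_append_iff (hlen hL).symm] at h
      exact absurd h.1 hL.not_rightSizes_ge
  | @right L R R' hR ih =>
    cases hY with
    | root A B _ =>
      have e : rightSizes (node () A (node () B R)) =
          (rightSizes A ++ (node () B R).numNodes :: rightSizes B) ++
            R.numNodes :: rightSizes R := by simp [rightSizes]
      rw [e, rightSizes, forall₂_append_iff (by simp [rightSizes]), List.forall₂_cons] at h
      exact absurd h.2.2 hR.not_rightSizes_ge
    | @left _ L'' _ h' =>
      rw [rightSizes, rightSizes, forall₂_append_iff (hlen h'), List.forall₂_cons] at h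
      exact absurd h.2.2 hR.not_rightSizes_ge
    | @right _ _ R'' h' =>
      rw [rightSizes, rightSizes, forall₂_append_iff rfl, List.forall₂_cons] at h
      rw [ih h' h.2.2]

end CanopyTree

/-! ### The isomorphism and its covering relations -/

open CanopyTree GridPath

theorem proposition8 (v : GridPath) :
    ∃ e : CanopyInterval v ≃o Tam v,
      (∀ T : CanopyInterval v, (e T).1 = CanopyTree.upperPath T.1) ∧
      (∀ T : CanopyInterval v, ∀ S : BinaryTree Unit,
        CanopyTree.ValidRightRotation T.1 S ↔
          ∃ hS : CanopyTree.HasCanopy v S,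
            GridPath.TamStep v (e T).1 (e ⟨S, hS⟩).1) ∧
      (∀ u u' : Tam v, u ⋖ u' ↔ GridPath.TamStep v u.1 u'.1) ∧
      (∀ T : CanopyInterval v,
        CanopyTree.rightHeights T.1 =
          (GridPath.points (CanopyTree.upperPath T.1)).map (GridPath.horiz v)) := by
  have rot_iff : ∀ {T S : BinaryTree Unit} (hT : HasCanopy v T) (hS : HasCanopy v S),
      ValidRightRotation T S ↔ TamStep v (upperPath T) (upperPath S) := by
    intro T S hT hS
    constructor
    · intro h
      have h1 := h.liftStep 0
      rw [← hT.heights_eq, ← hS.heights_eq] at h1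
      obtain ⟨u', h2, h3⟩ := h1.exists_tamStep hT.isAbove
      rwa [heights_injective h3] at h2
    · intro h
      have h1 := h.liftStep hT.isAbove
      rw [hT.heights_eq, hS.heights_eq] at h1
      obtain ⟨S', h2, h3⟩ := exists_validRightRotation T 0 _ h1
      rwa [rightHeightsInt_injective h3] at h2
  let f : CanopyInterval v → Tam v := fun T => ⟨upperPath T.1, T.2.isAbove⟩
  have hf : Function.Bijective f := by
    refine ⟨fun T S h => Subtype.ext ?_, fun u => ?_⟩
    · exact T.2.upperPath_injective S.2 (congrArg Subtype.val h)
    · obtain ⟨T, hT, h⟩ := exists_upperPath_eq u.2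
      exact ⟨⟨T, hT⟩, Subtype.ext h⟩
  have hle : ∀ T S : CanopyInterval v, f T ≤ f S ↔ T ≤ S := by
    intro T S
    constructor
    · intro h
      have key : ∀ w : Tam v, f T ≤ w → ∀ W : CanopyInterval v, f W = w → T ≤ W := by
        intro w hw
        induction hw with
        | refl => exact fun W hW => (hf.1 hW).ge
        | @tail b c hb hbc ih =>
          intro W hW
          obtain ⟨B, rfl⟩ := hf.2 b
          subst hW
          exact (ih B rfl).trans
            (Relation.ReflTransGen.single ((rot_iff B.2 W.2).2 hbc).rightRotation)
      exact key _ h S rfl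
    · intro h
      have key : ∀ W : BinaryTree Unit, TamariLE T.1 W → ∀ hW : HasCanopy v W,
          f T ≤ f ⟨W, hW⟩ := by
        intro W h
        induction h with
        | refl => exact fun _ => le_rfl
        | @tail b c hb hbc ih =>
          intro hc
          -- The chain may a priori leave `I(v)`. North steps of the canopy never increase along it
          -- and their number is the same at both ends, so the last rotation cannot be invalid.
          have h1 := TamariLE.count_canopy_le hb
          rcases hbc.valid_or_count_lt with h2 | h2
          · have hB : HasCanopy v b := ⟨hbc.ne_nil.1, h2.canopy_eq.symm.trans hc.2⟩
            exact (ih hB).trans (Relation.ReflTransGen.single ((rot_iff hB hc).1 h2))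
          · rw [T.2.2] at h1
            rw [hc.2] at h2
            omega
      exact key _ h S.2
  let e : CanopyInterval v ≃o Tam v := ⟨Equiv.ofBijective f hf, fun {T S} => hle T S⟩
  have step_lt : ∀ {u u' : Tam v}, TamStep v u.1 u'.1 → u < u' := by
    intro u u' h
    refine lt_of_le_of_ne (Relation.ReflTransGen.single h) ?_
    rintro rfl
    exact lt_irrefl _ h.inv_lt
  have exists_step : ∀ {u u' : Tam v}, u < u' → ∃ w : Tam v, TamStep v u.1 w.1 ∧ w ≤ u' := by
    intro u u' h
    rcases Relation.ReflTransGen.cases_head h.le with h1 | ⟨w, h1, h2⟩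
    · exact absurd h1 h.ne
    · exact ⟨w, h1, h2⟩
  refine ⟨e, fun _ => rfl, fun T S => ?_, fun u u' => ⟨fun h => ?_, fun h => ⟨step_lt h, ?_⟩⟩,
    fun T => T.2.rightHeights_eq⟩
  · constructor
    · intro h
      exact ⟨h.hasCanopy T.2, (rot_iff T.2 (h.hasCanopy T.2)).1 h⟩
    · rintro ⟨hS, h⟩
      exact (rot_iff T.2 hS).2 h
  · obtain ⟨w, h1, h2⟩ := exists_step h.lt
    rcases h2.eq_or_lt with rfl | h2
    · exact h1
    · exact absurd h2 (h.2 (step_lt h1))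
  · intro w hw hw'
    -- The first step towards `w` and the step to `u'` are two rotations of one tree with comparable
    -- results, hence equal, so `u' ≤ w`.
    obtain ⟨x, hx, hxw⟩ := exists_step hw
    obtain ⟨T, rfl⟩ := hf.2 u
    obtain ⟨S, rfl⟩ := hf.2 u'
    obtain ⟨X, rfl⟩ := hf.2 x
    have h1 := ((rot_iff T.2 X.2).2 hx).rightRotation
    have h2 := ((rot_iff T.2 S.2).2 h).rightRotation
    have h3 : X ≤ S := (hle _ _).1 (hxw.trans hw'.le)
    have h4 : X = S := Subtype.ext (h1.eq_of_rightSizes_le h2 (TamariLE.rightSizes_le h3))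
    rw [h4] at hxw
    exact absurd hw' hxw.not_gt
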